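/- Let $U \neq \{0\}$ be a real Banach space with a predual $P$, i.e. $P$ is a real Banach space together with an isometric isomorphism $U \cong P^*$; write $\langle \eta, u\rangle$ for the pairing of $\eta \in P$, $u \in U$. Suppose that $U$ has the approximation property: for every compact $K \subset U$ and $\varepsilon > 0$ there is a bounded finite rank operator $S \colon U \to U$ with $\|u - Su\| \le \varepsilon$ for all $u \in K$. Let $U \hat\otimes_{\pi,s} U$ be the symmetric projective tensor product, i.e. the completion of the algebraic symmetric tensor product $\mathrm{span}\{u \otimes u : u \in U\} \subset U \otimes U$ in the norm $$\pi_s(\omega) = \inf\Big\{ \sum_{i=1}^n |\lambda_i| : \omega = \sum_{i=1}^n \lambda_i\, u_i \otimes u_i,\ \|u_i\| = 1 \Big\}.$$ The elements of $U \hat\otimes_{\pi,s} U$ are regarded as bounded bilinear forms on $P$ through the continuous linear extension of $u \otimes u \mapsto \big((\eta,\eta') \mapsto \langle \eta,u\rangle\langle\eta',u\rangle\big)$; this map is injective. Let $c$ be a bounded symmetric bilinear form on $P$, and let the covariance operator $\mathcal C \colon P \to U$ be defined by $$\langle \eta', \mathcal C\eta\rangle = \langle c, \eta \otimes_s \eta'\rangle,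 \qquad \eta \otimes_s \eta' = \tfrac12(\eta \otimes \eta' + \eta' \otimes \eta), \quad \eta,\eta' \in P,$$ where $\langle c, \eta \otimes \eta'\rangle = c(\eta,\eta')$. Then $\mathcal C$ is symmetric ($\langle \eta', \mathcal C \eta\rangle = \langle \eta, \mathcal C\eta'\rangle$ for all $\eta, \eta'$) and nuclear if and only if $c \in U \hat\otimes_{\pi,s} U$. Here an operator $N \colon P \to U$ is nuclear if $N\eta = \sum_{i=1}^\infty \lambda_i\, e_i^*(\eta) f_i$ for all $\eta \in P$, with $e_i^* \in P^*$, $f_i \in U$, $\|e_i^*\| = \|f_i\| = 1$ and $\sum_i |\lambda_i| < \infty$. In this case there exist $\varphi_i \in U$ with $\|\varphi_i\| = 1$ and $\lambda_i \in \mathbb R$ with $\sum_{i=1}^\infty |\lambda_i| < \infty$ such that $$\mathcal C\eta = \sum_{i=1}^\infty \lambda_i \langle \eta, \varphi_i\rangle \varphi_i, \qquad \eta \in P.$$ In addition, for every such representation of $\mathcal C$ with $\lambda_i \ge 0$ for all $i$, the operator $\mathcal C$ is positive semidefinite, i.e. $\langle \eta, \mathcal C\eta\rangle \ge 0$ for all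 $\eta \in P$. -/

import Mathlib

open scoped TensorProduct

noncomputable section

/-- The approximation property: the identity is approximated, uniformly on every compact set, by
(bounded) operators of finite rank. -/
def HasApproximationProperty (E : Type*) [NormedAddCommGroup E] [NormedSpace ℝ E] : Prop :=
  ∀ K : Set E, IsCompact K → ∀ ε : ℝ, 0 < ε →
    ∃ S : E →L[ℝ] E, FiniteDimensional ℝ (LinearMap.range S.toLinearMap) ∧
      ∀ e ∈ K, ‖e - S e‖ ≤ ε

/-- Nuclear operators between Banach spaces: `N e = ∑ i, lam i * ⟨e, e*_i⟩ • f_i` with unit vectors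
`e*_i`, `f_i` and absolutely summable scalars `lam i`. -/
def IsNuclearOperator {E F : Type*} [NormedAddCommGroup E] [NormedSpace ℝ E]
    [NormedAddCommGroup F] [NormedSpace ℝ F] (N : E →L[ℝ] F) : Prop :=
  ∃ (lam : ℕ → ℝ) (e' : ℕ → StrongDual ℝ E) (f : ℕ → F),
    (∀ i, ‖e' i‖ = 1) ∧ (∀ i, ‖f i‖ = 1) ∧ Summable (fun i => |lam i|) ∧
      ∀ e : E, HasSum (fun i => (lam i * e' i e) • f i) (N e)

/-! ### The symmetric projective tensor product -/

section SymProj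

variable (E : Type*) [NormedAddCommGroup E] [NormedSpace ℝ E]

/-- The algebraic symmetric tensor product of `E` with itself, as the subspace of `E ⊗ E` spanned
by the squares `e ⊗ e`. -/
def symTensorSubmodule : Submodule ℝ (E ⊗[ℝ] E) :=
  Submodule.span ℝ (Set.range fun e : E => e ⊗ₜ[ℝ] e)

/-- The algebraic symmetric tensor product as a type of its own; it carries the norm `π_s`. -/
def SymTensor : Type _ := symTensorSubmodule E

instance : AddCommGroup (SymTensor E) := inferInstanceAs (AddCommGroup (symTensorSubmodule E))

instance : Module ℝ (SymTensor E) := inferInstanceAs (Module ℝ (symTensorSubmodule E))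

variable {E}

/-- The inclusion of the symmetric tensors in `E ⊗ E`. -/
def SymTensor.incl : SymTensor E →ₗ[ℝ] E ⊗[ℝ] E := (symTensorSubmodule E).subtype

/-- The square `e ⊗ e`. -/
def SymTensor.sq (e : E) : SymTensor E := ⟨e ⊗ₜ[ℝ] e, Submodule.subset_span ⟨e, rfl⟩⟩

/-- The sums `∑ |lam i|` over all finite representations `w = ∑ lam i • (e i ⊗ e i)` with
unit vectors `e i`. -/
def SymTensor.costs (w : SymTensor E) : Set ℝ :=
  {r | ∃ (n : ℕ) (lam : Fin n → ℝ) (e : Fin n → E), (∀ i, ‖e i‖ = 1) ∧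
    w = ∑ i, lam i • SymTensor.sq (e i) ∧ r = ∑ i, |lam i|}

/-- The symmetric projective norm `π_s`. -/
instance : Norm (SymTensor E) := ⟨fun w => sInf w.costs⟩

theorem SymTensor.norm_def (w : SymTensor E) : ‖w‖ = sInf w.costs := rfl

theorem SymTensor.costs_nonneg {w : SymTensor E} {r : ℝ} (hr : r ∈ w.costs) : 0 ≤ r := by
  obtain ⟨n, lam, e, -, -, rfl⟩ := hr
  exact Finset.sum_nonneg fun i _ => abs_nonneg _

theorem SymTensor.costs_bddBelow (w : SymTensor E) : BddBelow w.costs :=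
  ⟨0, fun _ hr => SymTensor.costs_nonneg hr⟩

theorem SymTensor.costs_zero : (0 : ℝ) ∈ (0 : SymTensor E).costs :=
  ⟨0, Fin.elim0, Fin.elim0, fun i => i.elim0, by simp, by simp⟩

theorem SymTensor.costs_add {w z : SymTensor E} {r s : ℝ} (hr : r ∈ w.costs) (hs : s ∈ z.costs) :
    r + s ∈ (w + z).costs := by
  obtain ⟨n, lam, e, he, rfl, rfl⟩ := hr
  obtain ⟨m, mu, f, hf, rfl, rfl⟩ := hs
  refine ⟨n + m, Fin.append lam mu, Fin.append e f, ?_, ?_, ?_⟩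
  · intro i
    refine Fin.addCases (fun i => ?_) (fun i => ?_) i <;> simp [he, hf]
  · simp [Fin.sum_univ_add]
  · simp [Fin.sum_univ_add]

theorem SymTensor.costs_smul {w : SymTensor E} {r : ℝ} (a : ℝ) (hr : r ∈ w.costs) :
    |a| * r ∈ (a • w).costs := by
  obtain ⟨n, lam, e, he, rfl, rfl⟩ := hr
  exact ⟨n, fun i => a * lam i, e, he, by simp [Finset.smul_sum, mul_smul],
    by simp [abs_mul, Finset.mul_sum]⟩

theorem SymTensor.costs_sq (e : E) : ‖e‖ ^ 2 ∈ (SymTensor.sq e).costs := by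
  rcases eq_or_ne e 0 with rfl | he
  · have h : SymTensor.sq (0 : E) = 0 := Subtype.ext (by simp [SymTensor.sq]; rfl)
    rw [h]
    simpa using SymTensor.costs_zero (E := E)
  · have hn : ‖e‖ ≠ 0 := norm_ne_zero_iff.mpr he
    refine ⟨1, fun _ => ‖e‖ ^ 2, fun _ => ‖e‖⁻¹ • e, fun _ => ?_, ?_, by simp⟩
    · rw [norm_smul, norm_inv, norm_norm, inv_mul_cancel₀ hn]
    · apply Subtype.ext
      change e ⊗ₜ[ℝ] e = SymTensor.incl (∑ i : Fin 1, _)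
      rw [map_sum]
      simp only [Finset.univ_unique, Finset.sum_singleton, map_smul]
      change e ⊗ₜ[ℝ] e = ‖e‖ ^ 2 • ((‖e‖⁻¹ • e) ⊗ₜ[ℝ] (‖e‖⁻¹ • e))
      rw [TensorProduct.smul_tmul_smul, smul_smul]
      have : ‖e‖ ^ 2 * (‖e‖⁻¹ * ‖e‖⁻¹) = 1 := by field_simp
      rw [this, one_smul]

theorem SymTensor.costs_nonempty (w : SymTensor E) : w.costs.Nonempty := by
  obtain ⟨w, hw⟩ := w
  induction hw using Submodule.span_induction with
  | mem x hx =>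
    obtain ⟨e, rfl⟩ := hx
    exact ⟨_, SymTensor.costs_sq e⟩
  | zero => exact ⟨_, SymTensor.costs_zero⟩
  | add x y hx hy h1 h2 =>
    obtain ⟨r, hr⟩ := h1
    obtain ⟨s, hs⟩ := h2
    exact ⟨_, SymTensor.costs_add hr hs⟩
  | smul a x hx h =>
    obtain ⟨r, hr⟩ := h
    exact ⟨_, SymTensor.costs_smul a hr⟩

theorem SymTensor.norm_smul_le' (a : ℝ) (w : SymTensor E) : ‖a • w‖ ≤ |a| * ‖w‖ := by
  rw [SymTensor.norm_def w, ← smul_eq_mul, ← Real.sInf_smul_of_nonneg (abs_nonneg a)]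
  refine le_csInf ((SymTensor.costs_nonempty w).smul_set) ?_
  rintro _ ⟨r, hr, rfl⟩
  exact csInf_le (SymTensor.costs_bddBelow _) (SymTensor.costs_smul a hr)

theorem SymTensor.core : SeminormedSpace.Core ℝ (SymTensor E) where
  norm_nonneg w := Real.sInf_nonneg fun _ hr => SymTensor.costs_nonneg hr
  norm_smul a w := by
    refine le_antisymm (SymTensor.norm_smul_le' a w) ?_
    rcases eq_or_ne a 0 with rfl | ha
    · rw [norm_zero, zero_mul]
      exact Real.sInf_nonneg fun _ hr => SymTensor.costs_nonneg hr
    · have h := SymTensor.norm_smul_le' a⁻¹ (a • w)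
      rw [inv_smul_smul₀ ha, abs_inv] at h
      calc ‖a‖ * ‖w‖ ≤ |a| * (|a|⁻¹ * ‖a • w‖) := by
            rw [Real.norm_eq_abs]; gcongr
        _ = ‖a • w‖ := mul_inv_cancel_left₀ (abs_ne_zero.mpr ha) _
  norm_triangle w z := by
    refine le_of_forall_pos_le_add fun ε hε => ?_
    obtain ⟨r, hr, hr'⟩ := Real.lt_sInf_add_pos (SymTensor.costs_nonempty w) (half_pos hε)
    obtain ⟨s, hs, hs'⟩ := Real.lt_sInf_add_pos (SymTensor.costs_nonempty z) (half_pos hε)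
    have h : ‖w + z‖ ≤ r + s :=
      csInf_le (SymTensor.costs_bddBelow _) (SymTensor.costs_add hr hs)
    rw [← SymTensor.norm_def] at hr' hs'
    linarith

instance : SeminormedAddCommGroup (SymTensor E) :=
  SeminormedAddCommGroup.ofCore (SymTensor.core (E := E))

instance : NormedSpace ℝ (SymTensor E) where
  norm_smul_le a w := (SymTensor.core.norm_smul a w).le

variable (E) in
/-- The symmetric projective tensor product: the completion of the algebraic one in the norm
`π_s`. -/
abbrev SymProjTensor : Type _ := UniformSpace.Completion (SymTensor E)

/-- Bounded operators on the symmetric tensors extend to the completion. -/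
def SymProjTensor.extend {F : Type*} [NormedAddCommGroup F] [NormedSpace ℝ F] [CompleteSpace F]
    (f : SymTensor E →L[ℝ] F) : SymProjTensor E →L[ℝ] F :=
  f.extend (UniformSpace.Completion.toComplL (𝕜 := ℝ) (E := SymTensor E))

theorem SymProjTensor.extend_coe {F : Type*} [NormedAddCommGroup F] [NormedSpace ℝ F]
    [CompleteSpace F] (f : SymTensor E →L[ℝ] F) (w : SymTensor E) :
    SymProjTensor.extend f (w : SymProjTensor E) = f w :=
  f.extend_eq (e := UniformSpace.Completion.toComplL (𝕜 := ℝ) (E := SymTensor E))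
    UniformSpace.Completion.denseRange_coe (UniformSpace.Completion.isUniformInducing_coe _) w

end SymProj

/-! ### Tensors over a dual space as operators and as bilinear forms on the predual

`J : U ≃ₗᵢ[ℝ] StrongDual ℝ P` presents `P` as a predual of `U`; the duality pairing is
`⟨η, u⟩ = J u η`. -/

section Predual

variable {P U : Type*} [NormedAddCommGroup P] [NormedSpace ℝ P]
  [NormedAddCommGroup U] [NormedSpace ℝ U]

/-- The linear map from `U ⊗ U` to operators `P → U` with `u ⊗ v ↦ (η ↦ ⟨η, u⟩ v)`. -/
def tensorOperator (J : U ≃ₗᵢ[ℝ] StrongDual ℝ P) : U ⊗[ℝ] U →ₗ[ℝ] (P →L[ℝ] U) :=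
  TensorProduct.lift (LinearMap.mk₂ ℝ (fun u v => (J u).smulRight v)
    (fun u u' v => by ext; simp [add_smul])
    (fun a u v => by ext; simp [mul_smul])
    (fun u v v' => by ext; simp)
    (fun a u v => by ext; simp [smul_comm a]))

theorem tensorOperator_tmul (J : U ≃ₗᵢ[ℝ] StrongDual ℝ P) (u v : U) (η : P) :
    tensorOperator J (u ⊗ₜ[ℝ] v) η = J u η • v := by
  simp [tensorOperator]

theorem norm_tensorOperator_le (J : U ≃ₗᵢ[ℝ] StrongDual ℝ P) (w : SymTensor U) :
    ‖tensorOperator J (SymTensor.incl w)‖ ≤ 1 * ‖w‖ := by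
  rw [one_mul]
  refine le_csInf (SymTensor.costs_nonempty w) ?_
  rintro _ ⟨n, lam, e, he, rfl, rfl⟩
  rw [map_sum, map_sum]
  refine norm_sum_le_of_le Finset.univ fun i _ => ?_
  rw [map_smul, map_smul, norm_smul, Real.norm_eq_abs]
  refine mul_le_of_le_one_right (abs_nonneg _) ?_
  refine ContinuousLinearMap.opNorm_le_bound _ zero_le_one fun η => ?_
  change ‖tensorOperator J (e i ⊗ₜ[ℝ] e i) η‖ ≤ _
  have h := (J (e i)).le_opNorm η
  rw [J.norm_map, he] at h
  rwa [tensorOperator_tmul, norm_smul, he, mul_one]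

/-- `tensorOperator` on the algebraic symmetric tensors, bounded for `π_s`. -/
def symTensorOperator (J : U ≃ₗᵢ[ℝ] StrongDual ℝ P) : SymTensor U →L[ℝ] (P →L[ℝ] U) :=
  LinearMap.mkContinuous ((tensorOperator J).comp (SymTensor.incl (E := U)) :
    SymTensor U →ₗ[ℝ] (P →L[ℝ] U)) 1 (norm_tensorOperator_le J)

/-- The continuous linear extension of `u ⊗ u ↦ (η ↦ ⟨η, u⟩ u)` to the symmetric projective
tensor product. -/
def symProjOperator [CompleteSpace U] (J : U ≃ₗᵢ[ℝ] StrongDual ℝ P) :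
    SymProjTensor U →L[ℝ] (P →L[ℝ] U) :=
  SymProjTensor.extend (symTensorOperator J)

/-- The canonical map from the symmetric projective tensor product of `U` to the bounded bilinear
forms on the predual, the continuous linear extension of
`u ⊗ u ↦ ((η, η') ↦ ⟨η, u⟩ ⟨η', u⟩)`. -/
def symProjForm [CompleteSpace U] (J : U ≃ₗᵢ[ℝ] StrongDual ℝ P) (w : SymProjTensor U) :
    P →L[ℝ] P →L[ℝ] ℝ :=
  J.toContinuousLinearEquiv.toContinuousLinearMap.comp (symProjOperator J w)

theorem symProjForm_sq [CompleteSpace U] (J : U ≃ₗᵢ[ℝ] StrongDual ℝ P) (u : U) (η η' : P) :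
    symProjForm J (SymTensor.sq u : SymProjTensor U) η η' = J u η * J u η' := by
  change J (symProjOperator J (SymTensor.sq u : SymProjTensor U) η) η' = _
  rw [symProjOperator, SymProjTensor.extend_coe]
  change J (tensorOperator J (u ⊗ₜ[ℝ] u) η) η' = _
  simp [tensorOperator_tmul]

/-- The symmetric product `η ⊗_s η' = (η ⊗ η' + η' ⊗ η) / 2`. -/
def symTmul (η η' : P) : P ⊗[ℝ] P := (1 / 2 : ℝ) • (η ⊗ₜ[ℝ] η' + η' ⊗ₜ[ℝ] η)

/-- The pairing `⟨c, w⟩` of a bilinear form with a tensor, `⟨c, η ⊗ η'⟩ = c(η, η')`. -/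
def formPairing (c : P →L[ℝ] P →L[ℝ] ℝ) : P ⊗[ℝ] P →ₗ[ℝ] ℝ :=
  TensorProduct.lift (LinearMap.mk₂ ℝ (fun η η' => c η η')
    (by simp) (by simp) (by simp) (by simp))

/-- The covariance operator `C : P → U` of `c`; it is characterised by
`⟨η', C η⟩ = ⟨c, η ⊗_s η'⟩`, see `covarianceOperator_pairing`. -/
def covarianceOperator (J : U ≃ₗᵢ[ℝ] StrongDual ℝ P) (c : P →L[ℝ] P →L[ℝ] ℝ) : P →L[ℝ] U :=
  J.symm.toContinuousLinearEquiv.toContinuousLinearMap.comp ((1 / 2 : ℝ) • (c + c.flip))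

theorem covarianceOperator_pairing (J : U ≃ₗᵢ[ℝ] StrongDual ℝ P) (c : P →L[ℝ] P →L[ℝ] ℝ)
    (η η' : P) : J (covarianceOperator J c η) η' = formPairing c (symTmul η η') := by
  simp [covarianceOperator, formPairing, symTmul]

/-- `C : P → U` is symmetric: `⟨η', C η⟩ = ⟨η, C η'⟩`. -/
def IsSymmetricOperator (J : U ≃ₗᵢ[ℝ] StrongDual ℝ P) (C : P →L[ℝ] U) : Prop :=
  ∀ η η' : P, J (C η) η' = J (C η') η

/-- `C : P → U` is positive semidefinite: `⟨η, C η⟩ ≥ 0`. -/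
def IsPosSemidefOperator (J : U ≃ₗᵢ[ℝ] StrongDual ℝ P) (C : P →L[ℝ] U) : Prop :=
  ∀ η : P, 0 ≤ J (C η) η

/-- `C η = ∑ i, lam i * ⟨η, φ i⟩ • φ i` with unit vectors `φ i` and absolutely summable
scalars `lam i`. -/
def IsDiagonalExpansion (J : U ≃ₗᵢ[ℝ] StrongDual ℝ P) (C : P →L[ℝ] U)
    (lam : ℕ → ℝ) (φ : ℕ → U) : Prop :=
  (∀ i, ‖φ i‖ = 1) ∧ Summable (fun i => |lam i|) ∧
    ∀ η : P, HasSum (fun i => (lam i * J (φ i) η) • φ i) (C η)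

end Predual

end

/-! ### The symmetric product as a bounded bilinear map -/

section SymMul

variable {E : Type*} [NormedAddCommGroup E] [NormedSpace ℝ E]

/-! Polarization makes the symmetric product a bounded bilinear map `SymProjTensor.mul` into the
completion. A nuclear expansion of the covariance operator therefore gives an absolutely convergent
series of symmetric products; its form is the symmetrization of `c`, that is, `c` itself.
Conversely, every element of the completion is an absolutely convergent series of squares of unit
vectors (`SymProjTensor.exists_series`), and the continuous map to operators turns it into a
diagonal expansion, which is nuclear.

Only injectivity needs the approximation property. If `w = ∑ lam i • e i ⊗ e i` has zero operator,
then `∑ lam i • S (e i) ⊗_s e i = 0` for every finite rank `S`. Writing `lam i = a i * b i` with `a`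
summable and `b` null, choose `S` close to the identity on the compact set of all `b i • e i` and
`0`. Then `w = ∑ a i • (b i • e i - S (b i • e i)) ⊗_s e i` has arbitrarily small norm. -/

theorem SymTensor.incl_injective : Function.Injective (SymTensor.incl (E := E)) :=
  Subtype.val_injective

theorem SymTensor.incl_sq (e : E) : SymTensor.incl (SymTensor.sq e) = e ⊗ₜ[ℝ] e := rfl

theorem SymTensor.norm_sq_le (e : E) : ‖SymTensor.sq e‖ ≤ ‖e‖ ^ 2 :=
  csInf_le (SymTensor.costs_bddBelow _) (SymTensor.costs_sq e)

/-- The symmetric product `(a ⊗ b + b ⊗ a) / 2`, given by polarization. -/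
noncomputable def SymTensor.polar (a b : E) : SymTensor E :=
  (1 / 4 : ℝ) • (SymTensor.sq (a + b) - SymTensor.sq (a - b))

theorem SymTensor.incl_polar (a b : E) :
    SymTensor.incl (SymTensor.polar a b) = (1 / 2 : ℝ) • (a ⊗ₜ[ℝ] b + b ⊗ₜ[ℝ] a) := by
  simp only [SymTensor.polar, map_smul, map_sub, SymTensor.incl_sq, TensorProduct.add_tmul,
    TensorProduct.tmul_add, TensorProduct.sub_tmul, TensorProduct.tmul_sub]
  module

theorem SymTensor.polar_self (a : E) : SymTensor.polar a a = SymTensor.sq a := by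
  apply SymTensor.incl_injective
  rw [SymTensor.incl_polar, SymTensor.incl_sq]
  module

/-- `SymTensor.polar` as a bilinear map. -/
noncomputable def SymTensor.polarLin : E →ₗ[ℝ] E →ₗ[ℝ] SymTensor E :=
  LinearMap.mk₂ ℝ SymTensor.polar
    (fun a a' b => SymTensor.incl_injective (by
      simp only [map_add, SymTensor.incl_polar, TensorProduct.add_tmul, TensorProduct.tmul_add]
      module))
    (fun r a b => SymTensor.incl_injective (by
      simp only [map_smul, SymTensor.incl_polar, ← TensorProduct.smul_tmul',
        TensorProduct.tmul_smul]
      module))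
    (fun a b b' => SymTensor.incl_injective (by
      simp only [map_add, SymTensor.incl_polar, TensorProduct.add_tmul, TensorProduct.tmul_add]
      module))
    (fun r a b => SymTensor.incl_injective (by
      simp only [map_smul, SymTensor.incl_polar, ← TensorProduct.smul_tmul',
        TensorProduct.tmul_smul]
      module))

/-- Both `a + b` and `a - b` have norm at most 2, so their squares cost at most 4 each and the bound
is `(4 + 4) / 4`. -/
theorem SymTensor.norm_polar_le_of_norm_le_one {a b : E} (ha : ‖a‖ ≤ 1) (hb : ‖b‖ ≤ 1) :
    ‖SymTensor.polar a b‖ ≤ 2 := by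
  have h1 : ‖SymTensor.sq (a + b)‖ ≤ 4 := by
    have := norm_add_le a b
    nlinarith [SymTensor.norm_sq_le (a + b), norm_nonneg (a + b)]
  have h2 : ‖SymTensor.sq (a - b)‖ ≤ 4 := by
    have := norm_sub_le a b
    nlinarith [SymTensor.norm_sq_le (a - b), norm_nonneg (a - b)]
  have h3 := norm_sub_le (SymTensor.sq (a + b)) (SymTensor.sq (a - b))
  rw [SymTensor.polar, norm_smul, Real.norm_eq_abs, abs_of_pos (by norm_num)]
  linarith

theorem SymTensor.norm_polarLin_le (a b : E) :
    ‖SymTensor.polarLin a b‖ ≤ 2 * ‖a‖ * ‖b‖ := by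
  rcases eq_or_ne a 0 with rfl | ha
  · simp
  rcases eq_or_ne b 0 with rfl | hb
  · simp
  have ha' := norm_ne_zero_iff.mpr ha
  have hb' := norm_ne_zero_iff.mpr hb
  have key : SymTensor.polarLin a b =
      (‖a‖ * ‖b‖) • SymTensor.polarLin (‖a‖⁻¹ • a) (‖b‖⁻¹ • b) := by
    simp only [map_smul, LinearMap.smul_apply, smul_smul]
    rw [show ‖a‖ * ‖b‖ * (‖b‖⁻¹ * ‖a‖⁻¹) = 1 by field_simp, one_smul]
  have h : ‖SymTensor.polarLin (‖a‖⁻¹ • a) (‖b‖⁻¹ • b)‖ ≤ 2 :=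
    SymTensor.norm_polar_le_of_norm_le_one (by simp [norm_smul, ha']) (by simp [norm_smul, hb'])
  rw [key, norm_smul, Real.norm_of_nonneg (by positivity), mul_assoc 2, mul_comm 2]
  exact mul_le_mul_of_nonneg_left h (mul_nonneg (norm_nonneg a) (norm_nonneg b))

/-- The symmetric product with values in the symmetric projective tensor product. -/
noncomputable def SymProjTensor.mul : E →L[ℝ] E →L[ℝ] SymProjTensor E :=
  LinearMap.mkContinuous₂
    (SymTensor.polarLin.compr₂
      (UniformSpace.Completion.toComplL (𝕜 := ℝ) (E := SymTensor E)).toLinearMap) 2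
    (fun a b => by
      change ‖((SymTensor.polarLin a b : SymTensor E) : SymProjTensor E)‖ ≤ _
      rw [UniformSpace.Completion.norm_coe]
      exact SymTensor.norm_polarLin_le a b)

theorem SymProjTensor.mul_apply (a b : E) :
    SymProjTensor.mul a b = (SymTensor.polar a b : SymProjTensor E) := rfl

theorem SymProjTensor.mul_self (a : E) :
    SymProjTensor.mul a a = (SymTensor.sq a : SymProjTensor E) := by
  rw [SymProjTensor.mul_apply, SymTensor.polar_self]

end SymMul

/-! ### Series representations -/

section Series

variable {E : Type*} [NormedAddCommGroup E] [NormedSpace ℝ E]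

/-- A nearly optimal finite representation is padded with zero coefficients; the padding still needs
a unit vector, hence `Nontrivial`. The bound on `r` keeps the total mass finite when countably many
such series are merged. -/
theorem SymTensor.exists_series [Nontrivial E] (w : SymTensor E) {ε : ℝ} (hε : 0 < ε) :
    ∃ (lam : ℕ → ℝ) (e : ℕ → E) (r : ℝ), (∀ i, ‖e i‖ = 1) ∧ HasSum (fun i => |lam i|) r ∧
      r < ‖w‖ + ε ∧ HasSum (fun i => lam i • SymProjTensor.mul (e i) (e i)) (w : SymProjTensor E) := by
  obtain ⟨e₀, he₀⟩ := exists_norm_eq E zero_le_one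
  obtain ⟨r, ⟨n, lam, e, he, hw, hr⟩, hlt⟩ :=
    Real.lt_sInf_add_pos (SymTensor.costs_nonempty w) hε
  set lam' : ℕ → ℝ := fun i => if h : i < n then lam ⟨i, h⟩ else 0 with hlam'
  set e' : ℕ → E := fun i => if h : i < n then e ⟨i, h⟩ else e₀ with he'
  have hlam0 : ∀ i ∉ Finset.range n, lam' i = 0 := fun i hi => dif_neg (by simpa using hi)
  refine ⟨lam', e', r, fun i => ?_, ?_, hlt, ?_⟩
  · simp only [he']
    split_ifs <;> simp [*]
  · have h : HasSum (fun i => |lam' i|) (∑ i ∈ Finset.range n, |lam' i|) :=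
      hasSum_sum_of_ne_finset_zero fun i hi => by rw [hlam0 i hi, abs_zero]
    rw [Finset.sum_range] at h
    simpa [hr, hlam'] using h
  · have h : HasSum (fun i => lam' i • SymProjTensor.mul (e' i) (e' i))
        (∑ i ∈ Finset.range n, lam' i • SymProjTensor.mul (e' i) (e' i)) :=
      hasSum_sum_of_ne_finset_zero fun i hi => by rw [hlam0 i hi, zero_smul]
    have hw' : (w : SymProjTensor E) = ∑ i : Fin n, lam i • SymProjTensor.mul (e i) (e i) := by
      change UniformSpace.Completion.toComplL (𝕜 := ℝ) w = _
      rw [hw, map_sum]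
      refine Finset.sum_congr rfl fun i _ => ?_
      rw [map_smul, SymProjTensor.mul_self]
      rfl
    rw [Finset.sum_range] at h
    simp only [hlam', he', Fin.is_lt, dite_true] at h
    rw [hw']
    exact h

theorem SymProjTensor.summable_of_norm_eq_one {lam : ℕ → ℝ} {e f : ℕ → E}
    (he : ∀ i, ‖e i‖ = 1) (hf : ∀ i, ‖f i‖ = 1) (hlam : Summable fun i => |lam i|) :
    Summable fun i => lam i • SymProjTensor.mul (e i) (f i) := by
  refine Summable.of_norm_bounded (hlam.mul_right ‖SymProjTensor.mul (E := E)‖) fun i => ?_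
  rw [norm_smul, Real.norm_eq_abs]
  gcongr
  simpa [he, hf] using (SymProjTensor.mul (E := E)).le_opNorm₂ (e i) (f i)

/-- Every element of the symmetric projective tensor product is an absolutely convergent series
of squares of unit vectors. -/
theorem SymProjTensor.exists_series [Nontrivial E] (w : SymProjTensor E) :
    ∃ (lam : ℕ → ℝ) (e : ℕ → E), (∀ i, ‖e i‖ = 1) ∧ Summable (fun i => |lam i|) ∧
      HasSum (fun i => lam i • SymProjTensor.mul (e i) (e i)) w := by
  have hmem : w ∈ closure ((UniformSpace.Completion.toComplL (𝕜 := ℝ)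
      (E := SymTensor E)).toLinearMap.toAddMonoidHom.range : Set (SymProjTensor E)) :=
    UniformSpace.Completion.denseRange_coe w
  obtain ⟨v, hv, hvmem, -, hvn⟩ := controlled_sum_of_mem_closure hmem
    (b := fun n => (1 / 2 : ℝ) ^ n) (fun n => by positivity)
  choose z hz using hvmem
  have hzv : ∀ n, (z n : SymProjTensor E) = v n := hz
  choose lam e r he hr hlt hs using fun n =>
    SymTensor.exists_series (z n) (ε := (1 / 2 : ℝ) ^ n) (by positivity)
  have hgeo : Summable fun n : ℕ => (1 / 2 : ℝ) ^ n := summable_geometric_two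
  have hvsum : Summable fun n => ‖v n‖ := by
    -- The geometric bound on `v n` holds only for `n > 0`, so the first term is dropped.
    refine (summable_nat_add_iff 1).mp ?_
    exact Summable.of_nonneg_of_le (fun _ => norm_nonneg _)
      (fun n => (hvn (n + 1) n.succ_pos).le) ((summable_nat_add_iff 1).mpr hgeo)
  have hvw : HasSum v w := by
    have h := (Summable.of_norm hvsum).hasSum
    rwa [tendsto_nhds_unique hv ((Filter.tendsto_add_atTop_iff_nat 1).mpr h.tendsto_sum_nat)]
  have hrsum : Summable r := by
    refine Summable.of_nonneg_of_le (fun n => (hr n).nonneg fun _ => abs_nonneg _) (fun n => ?_)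
      (hvsum.add hgeo)
    rw [← hzv, UniformSpace.Completion.norm_coe]
    exact (hlt n).le
  obtain ⟨σ⟩ : Nonempty (ℕ ≃ ℕ × ℕ) := ⟨Nat.pairEquiv.symm⟩
  have hlam : Summable fun p : ℕ × ℕ => |lam p.1 p.2| :=
    (summable_prod_of_nonneg fun _ => abs_nonneg _).mpr
      ⟨fun n => (hr n).summable, hrsum.congr fun n => (hr n).tsum_eq.symm⟩
  have hlamσ : Summable fun i => |lam (σ i).1 (σ i).2| := σ.summable_iff.mpr hlam
  have hsum := SymProjTensor.summable_of_norm_eq_one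
    (fun i => he (σ i).1 (σ i).2) (fun i => he (σ i).1 (σ i).2) hlamσ
  refine ⟨fun i => lam (σ i).1 (σ i).2, fun i => e (σ i).1 (σ i).2, fun i => he _ _, hlamσ, ?_⟩
  have hsum' : Summable fun p : ℕ × ℕ =>
      lam p.1 p.2 • SymProjTensor.mul (e p.1 p.2) (e p.1 p.2) := σ.summable_iff.mp hsum
  refine (σ.hasSum_iff (f := fun p : ℕ × ℕ =>
    lam p.1 p.2 • SymProjTensor.mul (e p.1 p.2) (e p.1 p.2))).mpr ?_
  rw [hvw.unique (hsum'.hasSum.prod_fiberwise fun n => by simpa only [hzv] using hs n)]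
  exact hsum'.hasSum

end Series

/-- An absolutely summable sequence is the product of an absolutely summable sequence and a null
sequence. -/
theorem exists_summable_mul_tendsto_zero {lam : ℕ → ℝ} (h : Summable fun i => |lam i|) :
    ∃ a b : ℕ → ℝ, (∀ i, lam i = a i * b i) ∧ Summable (fun i => |a i|) ∧
      Filter.Tendsto b Filter.atTop (nhds 0) := by
  -- The null factor is the square root of the tail of the series.
  set R : ℕ → ℝ := fun n => ∑' i, |lam (i + n)| with hR
  have hR0 : ∀ n, 0 ≤ R n := fun n => tsum_nonneg fun _ => abs_nonneg _
  have hstep : ∀ n, R n = |lam n| + R (n + 1) := fun n => by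
    have := ((summable_nat_add_iff n).mpr h).tsum_eq_zero_add
    simp only [hR]
    rw [this, zero_add]
    congr 2
    ext i
    congr 2
    ring
  have hsq : ∀ n, √(R n) * √(R n) = R n := fun n => Real.mul_self_sqrt (hR0 n)
  refine ⟨fun n => lam n / √(R n), fun n => √(R n), fun n => ?_, ?_, ?_⟩
  · rcases eq_or_ne √(R n) 0 with h0 | h0
    · have h1 : R n = 0 := by rw [← hsq, h0, zero_mul]
      have h2 : |lam n| = 0 := le_antisymm (by linarith [hstep n, hR0 (n + 1)]) (abs_nonneg _)
      simp [abs_eq_zero.mp h2]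
    · rw [div_mul_cancel₀ _ h0]
  · refine summable_of_sum_range_le (c := 2 * √(R 0)) (fun _ => abs_nonneg _) fun n => ?_
    -- Factor `|lam i| = R i - R (i + 1)` as a difference of squares and bound the sum of the roots
    -- by `2 * √(R i)`; the result telescopes.
    have hbound : ∀ i, |lam i / √(R i)| ≤ 2 * √(R i) - 2 * √(R (i + 1)) := fun i => by
      have hmono : √(R (i + 1)) ≤ √(R i) :=
        Real.sqrt_le_sqrt (by linarith [hstep i, abs_nonneg (lam i)])
      rw [abs_div, abs_of_nonneg (Real.sqrt_nonneg _)]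
      refine div_le_of_le_mul₀ (Real.sqrt_nonneg _) (by linarith) ?_
      nlinarith [hsq i, hsq (i + 1), hstep i]
    refine (Finset.sum_le_sum fun i _ => hbound i).trans ?_
    rw [Finset.sum_range_sub']
    linarith [Real.sqrt_nonneg (R n)]
  · have := (tendsto_sum_nat_add fun i => |lam i|).sqrt
    rwa [Real.sqrt_zero] at this

/-! ### Operators, forms and injectivity over the predual -/

section Predual

variable {P U : Type*} [NormedAddCommGroup P] [NormedSpace ℝ P]
  [NormedAddCommGroup U] [NormedSpace ℝ U]

theorem covarianceOperator_apply_of_symmetric (J : U ≃ₗᵢ[ℝ] StrongDual ℝ P)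
    {c : P →L[ℝ] P →L[ℝ] ℝ} (hc : ∀ η η' : P, c η η' = c η' η) (η η' : P) :
    J (covarianceOperator J c η) η' = c η η' := by
  rw [covarianceOperator_pairing]
  simp [formPairing, symTmul, hc η' η]
  ring

theorem isSymmetricOperator_covarianceOperator (J : U ≃ₗᵢ[ℝ] StrongDual ℝ P)
    (c : P →L[ℝ] P →L[ℝ] ℝ) : IsSymmetricOperator J (covarianceOperator J c) := fun η η' => by
  rw [covarianceOperator_pairing, covarianceOperator_pairing, symTmul, symTmul, add_comm]

theorem IsDiagonalExpansion.isNuclearOperator {J : U ≃ₗᵢ[ℝ] StrongDual ℝ P} {C : P →L[ℝ] U}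
    {lam : ℕ → ℝ} {φ : ℕ → U} (h : IsDiagonalExpansion J C lam φ) : IsNuclearOperator C :=
  ⟨lam, fun i => J (φ i), φ, fun i => by rw [J.norm_map, h.1], h.1, h.2.1, h.2.2⟩

theorem IsDiagonalExpansion.isPosSemidefOperator {J : U ≃ₗᵢ[ℝ] StrongDual ℝ P} {C : P →L[ℝ] U}
    {lam : ℕ → ℝ} {φ : ℕ → U} (h : IsDiagonalExpansion J C lam φ) (hlam : ∀ i, 0 ≤ lam i) :
    IsPosSemidefOperator J C := fun η => by
  have hs := ((ContinuousLinearMap.apply ℝ ℝ η).comp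
    J.toContinuousLinearEquiv.toContinuousLinearMap).hasSum (h.2.2 η)
  refine hs.nonneg fun i => ?_
  have : 0 ≤ lam i * (J (φ i) η * J (φ i) η) := mul_nonneg (hlam i) (mul_self_nonneg _)
  simpa [mul_assoc] using this

variable [CompleteSpace U]

theorem symProjOperator_mul (J : U ≃ₗᵢ[ℝ] StrongDual ℝ P) (u v : U) (η : P) :
    symProjOperator J (SymProjTensor.mul u v) η = (1 / 2 : ℝ) • (J u η • v + J v η • u) := by
  rw [SymProjTensor.mul_apply, symProjOperator, SymProjTensor.extend_coe]
  change tensorOperator J (SymTensor.incl (SymTensor.polar u v)) η = _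
  simp [SymTensor.incl_polar, tensorOperator_tmul]

theorem symProjOperator_mul_self (J : U ≃ₗᵢ[ℝ] StrongDual ℝ P) (u : U) (η : P) :
    symProjOperator J (SymProjTensor.mul u u) η = J u η • u := by
  rw [symProjOperator_mul]
  module

theorem hasSum_symProjOperator (J : U ≃ₗᵢ[ℝ] StrongDual ℝ P) {f : ℕ → SymProjTensor U}
    {w : SymProjTensor U} (h : HasSum f w) (η : P) :
    HasSum (fun i => symProjOperator J (f i) η) (symProjOperator J w η) :=
  ((ContinuousLinearMap.apply ℝ U η).comp (symProjOperator J)).hasSum h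

/-- With the approximation property, a symmetric projective tensor is determined by its
operator on the predual. -/
theorem symProjOperator_eq_zero [Nontrivial U] (J : U ≃ₗᵢ[ℝ] StrongDual ℝ P)
    (hU : HasApproximationProperty U) {w : SymProjTensor U} (hw : symProjOperator J w = 0) :
    w = 0 := by
  obtain ⟨lam, e, he, hlam, hs⟩ := SymProjTensor.exists_series w
  obtain ⟨a, b, hab, ha, hb⟩ := exists_summable_mul_tendsto_zero hlam
  -- The hypothesis concerns only functionals coming from `P`. It extends to all `x` in the dual of
  -- `U` because the two factors of a square are interchangeable: apply `x` to the operator's value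
  -- at `η`, and let `η` separate points of `U`.
  have hzero : ∀ x : StrongDual ℝ U, HasSum (fun i => (lam i * x (e i)) • e i) 0 := by
    intro x
    have hsum : Summable fun i => (lam i * x (e i)) • e i := by
      refine Summable.of_norm_bounded (hlam.mul_right ‖x‖) fun i => ?_
      have := x.le_opNorm (e i)
      rw [he, mul_one] at this
      rw [norm_smul, he, mul_one, norm_mul, Real.norm_eq_abs]
      gcongr
    convert hsum.hasSum
    symm
    apply J.injective
    ext η
    have h1 := x.hasSum (hasSum_symProjOperator J hs η)
    have h2 := ((ContinuousLinearMap.apply ℝ ℝ η).comp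
      J.toContinuousLinearEquiv.toContinuousLinearMap).hasSum hsum.hasSum
    have heq : ∀ i, x (symProjOperator J (lam i • SymProjTensor.mul (e i) (e i)) η) =
        J ((lam i * x (e i)) • e i) η := fun i => by
      rw [map_smul, map_smul, smul_apply, smul_apply, symProjOperator_mul_self, map_smul,
        map_smul, smul_eq_mul, smul_eq_mul, smul_eq_mul]
      ring
    simp only [heq, hw, zero_apply, map_zero] at h1
    rw [map_zero, zero_apply]
    exact h2.unique h1
  have hv : Filter.Tendsto (fun i => b i • e i) Filter.atTop (nhds 0) := by
    rw [tendsto_zero_iff_norm_tendsto_zero]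
    simpa [norm_smul, he] using hb.norm
  set A := ∑' i, |a i| with hA
  have hA0 : 0 ≤ A := tsum_nonneg fun _ => abs_nonneg _
  refine norm_le_zero_iff.mp (le_of_forall_pos_le_add fun δ hδ => ?_)
  set M := ‖SymProjTensor.mul (E := U)‖ with hM
  have hM0 : 0 ≤ M := norm_nonneg (SymProjTensor.mul (E := U))
  -- The final estimate is `A * M * ε ≤ δ`; the `+ 1` keeps the denominator positive.
  set ε := δ / (A * M + 1) with hεdef
  have hε : 0 < ε := by positivity
  obtain ⟨S, hfin, hS⟩ := hU _ hv.isCompact_insert_range ε hε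
  have hS' : ∀ i, ‖b i • e i - S (b i • e i)‖ ≤ ε := fun i =>
    hS _ (Set.mem_insert_of_mem _ ⟨i, rfl⟩)
  -- In a basis of its range, `S` is a finite sum of rank one operators, and `hzero` kills the
  -- contribution of each.
  have hSzero : HasSum (fun i => lam i • SymProjTensor.mul (S (e i)) (e i)) 0 := by
    let B := Module.finBasis ℝ (LinearMap.range S.toLinearMap)
    let x : Fin (Module.finrank ℝ (LinearMap.range S.toLinearMap)) → StrongDual ℝ U := fun j =>
      (LinearMap.toContinuousLinearMap (B.coord j)).comp
        (S.codRestrict (LinearMap.range S.toLinearMap) fun u => ⟨u, rfl⟩)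
    have hexp : ∀ u, S u = ∑ j, x j u • (B j : U) := fun u => by
      have := congrArg Subtype.val
        (B.sum_repr (S.codRestrict (LinearMap.range S.toLinearMap) (fun u => ⟨u, rfl⟩) u))
      rw [AddSubmonoidClass.coe_finsetSum] at this
      exact this.symm
    have h := hasSum_sum (s := Finset.univ) fun j _ =>
      (SymProjTensor.mul (B j : U)).hasSum (hzero (x j))
    simp only [map_zero, Finset.sum_const_zero] at h
    convert h using 2 with i
    rw [hexp, map_sum, sum_apply, Finset.smul_sum]
    refine Finset.sum_congr rfl fun j _ => ?_
    simp [mul_smul]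
  have hdiff : HasSum (fun i => a i • SymProjTensor.mul (b i • e i - S (b i • e i)) (e i)) w := by
    have h := hs.sub hSzero
    rw [sub_zero] at h
    convert h using 2 with i
    simp only [hab, map_smul, map_sub, smul_apply,
      sub_apply, mul_smul, smul_sub]
  have hle : ‖w‖ ≤ A * (M * ε) := by
    refine hdiff.norm_le_of_bounded (ha.hasSum.mul_right (M * ε)) fun i => ?_
    rw [norm_smul, Real.norm_eq_abs]
    gcongr
    refine ((SymProjTensor.mul (E := U)).le_opNorm₂ _ _).trans ?_
    rw [he, mul_one]
    gcongr
    exact hS' i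
  rw [zero_add]
  refine hle.trans ?_
  rw [hεdef, ← mul_assoc, mul_div_assoc', div_le_iff₀ (by positivity)]
  nlinarith

theorem symProjForm_injective [Nontrivial U] (J : U ≃ₗᵢ[ℝ] StrongDual ℝ P)
    (hU : HasApproximationProperty U) : Function.Injective (symProjForm J) := by
  intro w z h
  have h' : symProjOperator J w = symProjOperator J z := by
    ext η
    exact J.injective (DFunLike.congr_fun h η)
  exact sub_eq_zero.mp (symProjOperator_eq_zero J hU (by rw [map_sub, h', sub_self]))

theorem covarianceOperator_symProjForm (J : U ≃ₗᵢ[ℝ] StrongDual ℝ P) {w : SymProjTensor U}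
    (hw : ∀ η η' : P, symProjForm J w η η' = symProjForm J w η' η) :
    covarianceOperator J (symProjForm J w) = symProjOperator J w := by
  ext η
  apply J.injective
  ext η'
  exact covarianceOperator_apply_of_symmetric J hw η η'

theorem exists_isDiagonalExpansion_symProjOperator [Nontrivial U] (J : U ≃ₗᵢ[ℝ] StrongDual ℝ P)
    (w : SymProjTensor U) :
    ∃ (lam : ℕ → ℝ) (φ : ℕ → U), IsDiagonalExpansion J (symProjOperator J w) lam φ := by
  obtain ⟨lam, e, he, hlam, hs⟩ := SymProjTensor.exists_series w
  refine ⟨lam, e, he, hlam, fun η => ?_⟩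
  simpa [symProjOperator_mul_self, smul_smul] using hasSum_symProjOperator J hs η

/-- Since `U` is the dual of `P`, the functionals of a nuclear expansion are themselves unit vectors
of `U` and can be multiplied symmetrically with the `f i`. -/
theorem mem_range_symProjForm_of_isNuclearOperator (J : U ≃ₗᵢ[ℝ] StrongDual ℝ P)
    {c : P →L[ℝ] P →L[ℝ] ℝ} (hc : ∀ η η' : P, c η η' = c η' η)
    (h : IsNuclearOperator (covarianceOperator J c)) : c ∈ Set.range (symProjForm J) := by
  obtain ⟨lam, e', f, he', hf, hlam, hs⟩ := h
  have hu : ∀ i, ‖J.symm (e' i)‖ = 1 := fun i => by rw [J.symm.norm_map, he']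
  have hsum := SymProjTensor.summable_of_norm_eq_one hu hf hlam
  have hpair : ∀ η η', HasSum (fun i => lam i * e' i η * J (f i) η') (c η η') := fun η η' => by
    have := ((ContinuousLinearMap.apply ℝ ℝ η').comp
      J.toContinuousLinearEquiv.toContinuousLinearMap).hasSum (hs η)
    rw [← covarianceOperator_apply_of_symmetric J hc]
    simpa using this
  refine ⟨∑' i, lam i • SymProjTensor.mul (J.symm (e' i)) (f i), ?_⟩
  ext η η'
  have h1 := ((ContinuousLinearMap.apply ℝ ℝ η').comp
    J.toContinuousLinearEquiv.toContinuousLinearMap).hasSum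
      (hasSum_symProjOperator J hsum.hasSum η)
  -- The symmetric product averages over the two orders of the arguments, which leaves the symmetric
  -- form `c` unchanged.
  have h2 := ((hpair η η').add (hpair η' η)).mul_left (1 / 2)
  have h3 : (1 / 2 : ℝ) * (c η η' + c η' η) = c η η' := by rw [hc η' η]; ring
  rw [h3] at h2
  have heq : ∀ i, J (symProjOperator J (lam i • SymProjTensor.mul (J.symm (e' i)) (f i)) η) η' =
      1 / 2 * (lam i * e' i η * J (f i) η' + lam i * e' i η' * J (f i) η) := fun i => by
    rw [map_smul, smul_apply, symProjOperator_mul]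
    simp
    ring
  simp only [← heq] at h2
  exact h1.unique h2

end Predual

theorem mainTheorem9 {P U : Type*} [NormedAddCommGroup P] [NormedSpace ℝ P] [CompleteSpace P]
    [NormedAddCommGroup U] [NormedSpace ℝ U] [CompleteSpace U] [Nontrivial U]
    (J : U ≃ₗᵢ[ℝ] StrongDual ℝ P) (hU : HasApproximationProperty U)
    (c : P →L[ℝ] P →L[ℝ] ℝ) (hc : ∀ η η' : P, c η η' = c η' η) :
    Function.Injective (symProjForm J) ∧
    ((IsSymmetricOperator J (covarianceOperator J c) ∧
        IsNuclearOperator (covarianceOperator J c)) ↔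
      c ∈ Set.range (symProjForm J)) ∧
    (c ∈ Set.range (symProjForm J) →
      ∃ (lam : ℕ → ℝ) (φ : ℕ → U), IsDiagonalExpansion J (covarianceOperator J c) lam φ) ∧
    (∀ (lam : ℕ → ℝ) (φ : ℕ → U), IsDiagonalExpansion J (covarianceOperator J c) lam φ →
      (∀ i, 0 ≤ lam i) → IsPosSemidefOperator J (covarianceOperator J c)) := by
  refine ⟨symProjForm_injective J hU, ⟨fun h => mem_range_symProjForm_of_isNuclearOperator J hc h.2,
    ?_⟩, ?_, fun lam φ h hlam => h.isPosSemidefOperator hlam⟩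
  · rintro ⟨w, rfl⟩
    refine ⟨isSymmetricOperator_covarianceOperator J _, ?_⟩
    obtain ⟨lam, φ, h⟩ := exists_isDiagonalExpansion_symProjOperator J w
    rw [covarianceOperator_symProjForm J hc]
    exact h.isNuclearOperator
  · rintro ⟨w, rfl⟩
    rw [covarianceOperator_symProjForm J hc]
    exact exists_isDiagonalExpansion_symProjOperator J w
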